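/- Fix $q\in[0,1)$. For $n\ge 1$ let $\pi_{n,q}$ be the Mallows distribution on the symmetric group $\mathcal S_n$, $\pi_{n,q}(\sigma)=q^{\mathrm{Inv}(\sigma)}/\sum_{\tau\in\mathcal S_n}q^{\mathrm{Inv}(\tau)}$, where $\mathrm{Inv}(\sigma)=|\{i<j:\sigma(i)>\sigma(j)\}|$ (and $0^0=1$). For a finite sequence $x=(x_1,\dots,x_n)$ of distinct numbers let $T\langle x\rangle$ be its binary search tree, the set of words on $\{\mathbf 0,\mathbf 1\}$ given by $T\langle\,\rangle=\emptyset$ and $T\langle x\rangle=\{\varnothing\}\cup\mathbf 0\,T\langle x_-\rangle\cup\mathbf 1\,T\langle x_+\rangle$, where $x_-$ and $x_+$ are the subsequences of the entries smaller, respectively larger, than $x_1$; each word $u$ of the tree is joined by an edge to those of $u\mathbf 0,u\mathbf 1$ that lie in the tree. For two compact metric spaces with Borel probability measures $(E_1,d_1,\mu_1)$, $(E_2,d_2,\mu_2)$ let $d_{\mathrm{GHP}}$ be the infimum of the $\epsilon>0$ for which there are a measurable set $C\subseteq E_1\times E_2$ whose two coordinate projections are onto and a probability measure $M$ on $E_1\times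 E_2$ with marginals $\mu_1,\mu_2$ such that $M(C)\ge 1-\epsilon$ and $\sup\{|d_1(x_1,x_1')-d_2(x_2,x_2')|:(x_1,x_2),(x_1',x_2')\in C\}\le 2\epsilon$. Let $\sigma_n$, $n\ge 1$, be random permutations defined on a common probability space such that $\sigma_n$ has law $\pi_{n,q}$ for every $n$ (their joint law is arbitrary). Let $d_n$ be the graph distance in the tree $T\langle\sigma_n(1),\dots,\sigma_n(n)\rangle$ and $\mu_n$ the uniform distribution on its $n$ nodes. Then, almost surely, $$d_{\mathrm{GHP}}\Big(\big(T\langle\sigma_n\rangle,\ ((1-q)n)^{-1}d_n,\ \mu_n\big),\ \big([0,1],\ |x-y|,\ \mathrm{Leb}\big)\Big)\xrightarrow[n\to\infty]{}0 .$$ -/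

import Mathlib

open MeasureTheory ProbabilityTheory Filter Topology

noncomputable section

namespace MallowsGHP

/-! ## Mallows permutations -/

/-- The number of inversions of a permutation. -/
def invCount {n : ℕ} (σ : Equiv.Perm (Fin n)) : ℕ :=
  (Finset.univ.filter fun p : Fin n × Fin n => p.1 < p.2 ∧ σ p.2 < σ p.1).card

/-- The normalizing constant of the Mallows distribution. -/
def mallowsZ (n : ℕ) (q : ℝ) : ℝ := ∑ σ : Equiv.Perm (Fin n), q ^ invCount σ

/-- The probability of a permutation under the Mallows distribution. -/
def mallowsProb {n : ℕ} (q : ℝ) (σ : Equiv.Perm (Fin n)) : ℝ := q ^ invCount σ / mallowsZ n q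

instance permMeasurableSpace (n : ℕ) : MeasurableSpace (Equiv.Perm (Fin n)) := ⊤

/-- The Mallows distribution on the permutations of `Fin n` (a probability measure if `0 ≤ q`). -/
def mallows (n : ℕ) (q : ℝ) : Measure (Equiv.Perm (Fin n)) :=
  ∑ σ : Equiv.Perm (Fin n), ENNReal.ofReal (mallowsProb q σ) • Measure.dirac σ

/-! ## Binary search trees -/

/-- The binary search tree of a sequence, as a finite set of binary words: `false` is the letter
`0` (left), `true` is the letter `1` (right), and the empty word is the root. -/
def bst {α : Type*} [LinearOrder α] : List α → Finset (List Bool)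
  | [] => ∅
  | x :: xs =>
      {[]} ∪ (bst (xs.filter fun y => y < x)).image (List.cons false)
        ∪ (bst (xs.filter fun y => x < y)).image (List.cons true)
termination_by l => l.length
decreasing_by
  all_goals
    rw [List.length_unattach, List.length_cons]
    exact Nat.lt_succ_of_le ((List.length_filter_le _ _).trans List.length_attach.le)

/-- The infinite binary tree: each word `u` is joined to its two children `u0` and `u1`. -/
def binaryTree : SimpleGraph (List Bool) where
  Adj u v := (∃ b, v = u ++ [b]) ∨ (∃ b, u = v ++ [b])
  symm := ⟨fun _ _ h => h.symm⟩
  loopless := ⟨fun u h => by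
    rcases h with ⟨b, hb⟩ | ⟨b, hb⟩ <;> simpa using congrArg List.length hb⟩

/-- The binary search tree of a permutation `(σ(1), …, σ(n))`, as a graph. -/
def bstGraph {n : ℕ} (σ : Equiv.Perm (Fin n)) :
    SimpleGraph (bst (List.ofFn σ) : Set (List Bool)) :=
  binaryTree.induce (bst (List.ofFn σ) : Set (List Bool))

theorem nil_mem_bst {α : Type*} [LinearOrder α] {l : List α} (hl : l ≠ []) : [] ∈ bst l := by
  cases l with
  | nil => exact absurd rfl hl
  | cons x xs => rw [bst]; simp

theorem mem_bst_of_append {α : Type*} [LinearOrder α] (u v : List Bool) :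
    ∀ l : List α, u ++ v ∈ bst l → u ∈ bst l := by
  induction u with
  | nil =>
    intro l h
    apply nil_mem_bst
    rintro rfl
    simp [bst] at h
  | cons b u ih =>
    intro l h
    cases l with
    | nil => simp [bst] at h
    | cons x xs =>
      rw [bst] at h ⊢
      simp only [List.cons_append, Finset.mem_union, Finset.mem_singleton, Finset.mem_image,
        List.cons.injEq, reduceCtorEq, false_or] at h ⊢
      rcases h with ⟨w, hw, rfl, rfl⟩ | ⟨w, hw, rfl, rfl⟩
      · exact Or.inl ⟨u, ih _ hw, rfl, rfl⟩
      · exact Or.inr ⟨u, ih _ hw, rfl, rfl⟩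

theorem bstGraph_connected {n : ℕ} [NeZero n] (σ : Equiv.Perm (Fin n)) :
    (bstGraph σ).Connected := by
  have hl : List.ofFn σ ≠ [] := by
    intro h
    have := congrArg List.length h
    simp [NeZero.ne n] at this
  have key : ∀ (w : List Bool) (hw : w ∈ (bst (List.ofFn σ) : Set (List Bool))),
      (bstGraph σ).Reachable ⟨w, hw⟩ ⟨[], nil_mem_bst hl⟩ := by
    intro w
    induction w using List.reverseRecOn with
    | nil => intro hw; exact SimpleGraph.Reachable.refl _
    | append_singleton u b ih =>
      intro hw
      have hu : u ∈ (bst (List.ofFn σ) : Set (List Bool)) := mem_bst_of_append u [b] _ hw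
      refine SimpleGraph.Reachable.trans (SimpleGraph.Adj.reachable ?_) (ih hu)
      exact Or.inr ⟨b, rfl⟩
  have : Nonempty (bst (List.ofFn σ) : Set (List Bool)) := ⟨⟨[], nil_mem_bst hl⟩⟩
  exact ⟨fun u v => (key u.1 u.2).trans (key v.1 v.2).symm⟩

/-! ## Weighted metric spaces and the Gromov–Hausdorff–Prokhorov distance -/

/-- A weighted metric space: a compact metric space with a Borel probability measure. -/
structure WeightedMetricSpace where
  /-- the underlying set -/
  carrier : Type
  [metricSpace : MetricSpace carrier]
  [compactSpace : CompactSpace carrier]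
  [measurableSpace : MeasurableSpace carrier]
  [borelSpace : BorelSpace carrier]
  /-- the weight -/
  μ : Measure carrier
  [isProbabilityMeasure : IsProbabilityMeasure μ]

attribute [instance] WeightedMetricSpace.metricSpace WeightedMetricSpace.compactSpace
  WeightedMetricSpace.measurableSpace WeightedMetricSpace.borelSpace
  WeightedMetricSpace.isProbabilityMeasure

/-- A correspondence between two sets: both projections are onto. -/
def IsCorrespondence {E₁ E₂ : Type*} (C : Set (E₁ × E₂)) : Prop :=
  Prod.fst '' C = Set.univ ∧ Prod.snd '' C = Set.univ

/-- The distortion of a subset of a product of two metric spaces. -/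
def distortion {E₁ E₂ : Type*} [MetricSpace E₁] [MetricSpace E₂] (C : Set (E₁ × E₂)) : ℝ :=
  sSup {r : ℝ | ∃ x ∈ C, ∃ y ∈ C, r = |dist x.1 y.1 - dist x.2 y.2|}

/-- A coupling of two measures. -/
def IsCoupling {E₁ E₂ : Type*} [MeasurableSpace E₁] [MeasurableSpace E₂]
    (μ₁ : Measure E₁) (μ₂ : Measure E₂) (M : Measure (E₁ × E₂)) : Prop :=
  IsProbabilityMeasure M ∧ M.map Prod.fst = μ₁ ∧ M.map Prod.snd = μ₂

/-- The Gromov–Hausdorff–Prokhorov distance. -/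
def ghpDist (X Y : WeightedMetricSpace) : ℝ :=
  sInf {ε : ℝ | 0 < ε ∧ ∃ (C : Set (X.carrier × Y.carrier)) (M : Measure (X.carrier × Y.carrier)),
    IsCorrespondence C ∧ MeasurableSet C ∧ IsCoupling X.μ Y.μ M ∧
      ENNReal.ofReal (1 - ε) ≤ M C ∧ distortion C ≤ 2 * ε}

/-- Strong GHP convergence of random weighted metric spaces: the GHP distance to the limit tends
to `0` almost surely. -/
def StrongGHPTendsto {Ω : Type*} [MeasurableSpace Ω] (P : Measure Ω)
    (X : ℕ → Ω → WeightedMetricSpace) (Y : WeightedMetricSpace) : Prop :=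
  ∀ᵐ ω ∂P, Tendsto (fun n => ghpDist (X n ω) Y) atTop (𝓝 0)

/-- The graph distance of a connected graph, multiplied by `c > 0`. -/
@[reducible] def scaledGraphMetric {V : Type*} (G : SimpleGraph V) (hG : G.Connected)
    (c : ℝ) (hc : 0 < c) : MetricSpace V where
  dist u v := c * (G.dist u v : ℝ)
  dist_self u := by simp
  dist_comm u v := by rw [SimpleGraph.dist_comm]
  dist_triangle u v w := by
    rw [← mul_add]
    exact mul_le_mul_of_nonneg_left (by exact_mod_cast hG.dist_triangle) hc.le
  eq_of_dist_eq_zero {u v} h := by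
    have h' : c * (G.dist u v : ℝ) = 0 := h
    rcases mul_eq_zero.1 h' with h0 | h0
    · exact absurd h0 hc.ne'
    · exact hG.dist_eq_zero_iff.1 (by exact_mod_cast h0)

/-- A finite connected graph with `c` times its graph distance and the uniform measure on its
vertices. -/
def graphSpace {V : Type} [Finite V] (G : SimpleGraph V) (hG : G.Connected)
    (c : ℝ) (hc : 0 < c) : WeightedMetricSpace :=
  letI : MetricSpace V := scaledGraphMetric G hG c hc
  letI : MeasurableSpace V := ⊤
  haveI : BorelSpace V := ⟨borel_eq_top_of_discrete.symm⟩
  haveI : Nonempty V := hG.nonempty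
  { carrier := V
    μ := uniformOn (Set.univ : Set V) }

/-- The binary search tree of a permutation of size `n ≥ 1`, with its graph distance multiplied by
`((1 - q) n)⁻¹` and the uniform measure on its nodes. -/
def treeSpace (q : ℝ) (hq : q < 1) {n : ℕ} [NeZero n] (σ : Equiv.Perm (Fin n)) :
    WeightedMetricSpace :=
  graphSpace (bstGraph σ) (bstGraph_connected σ) ((1 - q) * n)⁻¹
    (inv_pos.2 (mul_pos (sub_pos.2 hq) (Nat.cast_pos.2 (Nat.pos_of_ne_zero (NeZero.ne n)))))

/-- The interval `[0, 1]` with the distance `|x - y|` and the uniform measure. -/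
def unitIntervalSpace : WeightedMetricSpace where
  carrier := unitInterval
  μ := volume

end MallowsGHP

end

/-! The all-right branch of the search tree carries the left-to-right maxima (records) of `σ`, and
the node holding the value `k` hangs off this spine at height `R k`, the number of records with
value below `k`. If `|R k - (1 - q) k| ≤ D` for every `k`, the whole geometry follows. The prefixes
of a word from the point where it leaves the spine all have the same `R`, so their values lie in a
window of width at most `2D / (1 - q)`, which bounds the excursion off the spine. Tree distances
then agree with `(1 - q) |k - l|` up to `O(D)`, and matching the value `k` with the `k`-th cell of
`[0, 1]` bounds the GHP distance (`ghpDist_treeSpace_le`).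

For the concentration, the inverse `τ` of `σ` is again Mallows. Removing `τ 0` splits off an
independent factor, and the value `0` is a record exactly when `τ 0 = 0`. Hence `R k` is a sum of
independent Bernoulli variables with parameters `(1 - q) / (1 - q ^ j)`, for `k` values of `j`
ending at `n`. Chernoff with `D = η n` and a union bound over `k` give a summable bound, and
Borel–Cantelli needs no information on the joint law. -/

namespace MallowsGHP

/-! ## Mallows permutations: the law of the number of records -/

/-- If `τ` is the inverse of `σ`, the number of left-to-right maxima of `σ` with value below `k`. -/
def recordCount {n : ℕ} (τ : Equiv.Perm (Fin n)) (k : ℕ) : ℕ :=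
  (Finset.univ.filter fun v : Fin n => (v : ℕ) < k ∧ ∀ w, v < w → τ v < τ w).card

/-- The permutation with first value `p` whose other values are ordered as in `e`. -/
def consPerm {n : ℕ} (p : Fin (n + 1)) (e : Equiv.Perm (Fin n)) : Equiv.Perm (Fin (n + 1)) :=
  -- The first factor fixes `0` and acts as `e` on successors; the second sends `0` to `p` and
  -- `j.succ` to `p.succAbove j`.
  (Equiv.Perm.decomposeFin.symm (0, e)).trans p.cycleRange.symm

@[simp] theorem consPerm_zero {n : ℕ} (p : Fin (n + 1)) (e : Equiv.Perm (Fin n)) :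
    consPerm p e 0 = p := by
  simp [consPerm]

@[simp] theorem consPerm_succ {n : ℕ} (p : Fin (n + 1)) (e : Equiv.Perm (Fin n)) (i : Fin n) :
    consPerm p e i.succ = p.succAbove (e i) := by
  simp [consPerm, Fin.cycleRange_symm_succ]

theorem consPerm_bijective (n : ℕ) :
    Function.Bijective fun x : Fin (n + 1) × Equiv.Perm (Fin n) => consPerm x.1 x.2 := by
  rw [Fintype.bijective_iff_injective_and_card]
  refine ⟨?_, by simp [Fintype.card_perm, Nat.factorial_succ]⟩
  rintro ⟨p, e⟩ ⟨p', e'⟩ h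
  have h' : consPerm p e = consPerm p' e' := h
  obtain rfl : p = p' := by simpa using congrArg (fun τ => τ 0) h'
  congr 1
  ext i
  have := congrArg (fun τ => τ i.succ) h'
  simp only [consPerm_succ] at this
  rw [Fin.succAbove_right_injective this]

/-- The first value `p` exceeds exactly `p` of the later ones, and the later ones keep their
relative order. -/
theorem invCount_consPerm {n : ℕ} (p : Fin (n + 1)) (e : Equiv.Perm (Fin n)) :
    invCount (consPerm p e) = p + invCount e := by
  have h1 : ∑ j : Fin n, (if p.succAbove (e j) < p then 1 else 0) = (p : ℕ) := by
    rw [Equiv.sum_comp e (fun j => if p.succAbove j < p then 1 else 0)]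
    simp only [Fin.succAbove_lt_iff_castSucc_lt]
    simp only [Fin.lt_def, Fin.val_castSucc]
    rw [← Finset.card_filter, Fin.card_filter_val_lt]
    have := p.2
    omega
  simp only [invCount, Finset.card_filter, Fintype.sum_prod_type, Fin.sum_univ_succ,
    consPerm_zero, consPerm_succ, Fin.succ_pos, true_and, Fin.succ_lt_succ_iff,
    Fin.succAbove_lt_succAbove_iff, h1]
  simp

/-- Being a record depends only on larger indices, so deleting index `0` leaves the other records
unchanged; index `0` is one iff `p` is the minimum. -/
theorem recordCount_consPerm {n : ℕ} (p : Fin (n + 1)) (e : Equiv.Perm (Fin n)) (k : ℕ) :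
    recordCount (consPerm p e) (k + 1) = (if p = 0 then 1 else 0) + recordCount e k := by
  have h0 : (∀ j : Fin n, p < p.succAbove (e j)) ↔ p = 0 := by
    constructor
    · intro h
      by_contra hp
      have hn : 0 < n := by
        rcases Nat.eq_zero_or_pos n with rfl | h
        · exact absurd (Fin.ext (by omega)) hp
        · exact h
      obtain ⟨j, hj⟩ := e.surjective ⟨0, hn⟩
      have := h j
      rw [hj, Fin.lt_succAbove_iff_le_castSucc, Fin.le_def] at this
      exact hp (Fin.ext (by simpa using this))
    · rintro rfl j
      simp
  simp only [recordCount, Finset.card_filter, Fin.sum_univ_succ, Fin.forall_fin_succ,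
    consPerm_zero, consPerm_succ, Fin.succ_pos, Fin.succ_lt_succ_iff,
    Fin.succAbove_lt_succAbove_iff]
  simp [h0]

theorem invCount_symm {n : ℕ} (σ : Equiv.Perm (Fin n)) : invCount σ.symm = invCount σ := by
  refine Finset.card_bij' (fun x _ => (σ.symm x.2, σ.symm x.1)) (fun x _ => (σ x.2, σ x.1))
    ?_ ?_ ?_ ?_ <;> simp +contextual

/-- The partition function of the Mallows distribution, weighted by `t` to the number of records. -/
def recordSum (q : ℝ) (n k : ℕ) (t : ℝ) : ℝ :=
  ∑ τ : Equiv.Perm (Fin n), q ^ invCount τ * t ^ recordCount τ k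

theorem recordSum_zero (q : ℝ) (n : ℕ) (t : ℝ) : recordSum q n 0 t = mallowsZ n q := by
  simp [recordSum, recordCount, mallowsZ]

theorem recordSum_one (q : ℝ) (n k : ℕ) : recordSum q n k 1 = mallowsZ n q := by
  simp [recordSum, mallowsZ]

/-- The first value `p` has weight `q ^ p`, with an extra `t` only for `p = 0`; this is the
independence of the Bernoulli factors. -/
theorem recordSum_succ (q : ℝ) (n k : ℕ) (t : ℝ) :
    recordSum q (n + 1) (k + 1) t =
      (t - 1 + ∑ i ∈ Finset.range (n + 1), q ^ i) * recordSum q n k t := by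
  have h : t - 1 + ∑ i ∈ Finset.range (n + 1), q ^ i =
      ∑ p : Fin (n + 1), q ^ (p : ℕ) * t ^ (if p = 0 then 1 else 0) := by
    rw [Finset.sum_range, Fin.sum_univ_succ, Fin.sum_univ_succ]
    simp
    ring
  rw [h, recordSum, ← (consPerm_bijective n).sum_comp, Fintype.sum_prod_type, recordSum,
    Finset.sum_mul_sum]
  refine Finset.sum_congr rfl fun p _ => Finset.sum_congr rfl fun e _ => ?_
  rw [invCount_consPerm, recordCount_consPerm, pow_add, pow_add]
  ring

/-! ### Exponential moments of the record count -/

theorem mallowsZ_pos {q : ℝ} (hq : 0 ≤ q) (n : ℕ) : 0 < mallowsZ n q := by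
  refine Finset.sum_pos' (fun σ _ => pow_nonneg hq _) ⟨1, Finset.mem_univ _, ?_⟩
  have : invCount (1 : Equiv.Perm (Fin n)) = 0 := by
    rw [invCount, Finset.card_eq_zero, Finset.filter_eq_empty_iff]
    rintro x - ⟨h1, h2⟩
    exact lt_asymm h1 h2
  simp [this]

/-- With `G` the geometric sum, a Bernoulli variable of parameter `1 / G` has exponential moment at
most `exp ((s + s ^ 2) / G)`. The term `2 * q ^ (n + 1)` pays for replacing `1 / G` by its limit `1
- q`. -/
theorem exp_sub_one_add_geom_le {q s : ℝ} (hq0 : 0 ≤ q) (hs : |s| ≤ 1) (n : ℕ) :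
    Real.exp s - 1 + ∑ i ∈ Finset.range (n + 1), q ^ i ≤
      (∑ i ∈ Finset.range (n + 1), q ^ i) *
        Real.exp ((s + s ^ 2) * (1 - q) + 2 * q ^ (n + 1)) := by
  set G := ∑ i ∈ Finset.range (n + 1), q ^ i with hG
  have hG1 : 1 ≤ G := by
    rw [hG, Finset.sum_range_succ']
    simpa using Finset.sum_nonneg fun i _ => pow_nonneg hq0 (i + 1)
  have hGq : (1 - q) * G = 1 - q ^ (n + 1) := by
    have := mul_geom_sum q (n + 1)
    rw [← hG] at this
    linarith
  have he := (abs_le.1 (Real.abs_exp_sub_one_sub_id_le hs)).2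
  have hs' := abs_le.1 hs
  have hs2 : s + s ^ 2 ≤ 2 := by nlinarith
  have hqn : 0 ≤ q ^ (n + 1) := pow_nonneg hq0 _
  have h1 : s + s ^ 2 ≤ G * ((s + s ^ 2) * (1 - q) + 2 * q ^ (n + 1)) := by
    have : G * ((s + s ^ 2) * (1 - q) + 2 * q ^ (n + 1)) =
      (s + s ^ 2) * (1 - q ^ (n + 1)) + 2 * (G * q ^ (n + 1)) := by rw [← hGq]; ring
    rw [this]
    nlinarith [mul_le_mul_of_nonneg_right hG1 hqn, mul_le_mul_of_nonneg_right hs2 hqn]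
  have h2 := mul_le_mul_of_nonneg_left
    (Real.add_one_le_exp ((s + s ^ 2) * (1 - q) + 2 * q ^ (n + 1))) (by linarith : 0 ≤ G)
  linarith

theorem recordSum_exp_le {q s : ℝ} (hq0 : 0 ≤ q) (hq1 : q < 1) (hs : |s| ≤ 1) {n k : ℕ}
    (hk : k ≤ n) :
    recordSum q n k (Real.exp s) ≤
      mallowsZ n q * Real.exp ((s + s ^ 2) * (1 - q) * k + 2 / (1 - q)) := by
  -- The replacement errors are kept as a partial geometric sum, so that the induction closes; they
  -- are bounded by `2 / (1 - q)` uniformly in `n` and `k` afterwards.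
  have main : ∀ (n k : ℕ), k ≤ n → recordSum q n k (Real.exp s) ≤ mallowsZ n q *
      Real.exp ((s + s ^ 2) * (1 - q) * k + 2 * ∑ i ∈ Finset.range (n + 1), q ^ i) := by
    intro n
    induction n with
    | zero =>
      intro k hk
      obtain rfl : k = 0 := by omega
      rw [recordSum_zero]
      refine le_mul_of_one_le_right (mallowsZ_pos hq0 _).le ?_
      simp
    | succ n ih =>
      intro k hk
      rcases k with _ | k
      · rw [recordSum_zero]
        refine le_mul_of_one_le_right (mallowsZ_pos hq0 _).le (Real.one_le_exp ?_)
        have := Finset.sum_nonneg fun i (_ : i ∈ Finset.range (n + 1 + 1)) => pow_nonneg hq0 i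
        simpa using this
      · have hZ : mallowsZ (n + 1) q =
            (∑ i ∈ Finset.range (n + 1), q ^ i) * mallowsZ n q := by
          rw [← recordSum_one q (n + 1) (0 + 1), recordSum_succ, recordSum_zero]
          simp
        have hG : 0 ≤ ∑ i ∈ Finset.range (n + 1), q ^ i :=
          Finset.sum_nonneg fun i _ => pow_nonneg hq0 i
        rw [recordSum_succ, hZ]
        refine (mul_le_mul (exp_sub_one_add_geom_le hq0 hs n) (ih k (by omega)) ?_
          (by positivity)).trans_eq ?_
        · exact Finset.sum_nonneg fun τ _ => by positivity
        · rw [mul_mul_mul_comm, ← Real.exp_add, Finset.sum_range_succ _ (n + 1)]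
          push_cast
          ring_nf
  refine (main n k hk).trans ?_
  have hg : ∑ i ∈ Finset.range (n + 1), q ^ i ≤ 1 / (1 - q) := by
    rw [le_div_iff₀ (by linarith)]
    have := mul_geom_sum q (n + 1)
    have : 0 ≤ q ^ (n + 1) := pow_nonneg hq0 _
    linarith
  have : 2 * ∑ i ∈ Finset.range (n + 1), q ^ i ≤ 2 / (1 - q) := by
    rw [show 2 / (1 - q) = 2 * (1 / (1 - q)) by ring]
    linarith
  have := mallowsZ_pos hq0 n
  gcongr

/-- The permutations whose number of records below some value is off its typical value by more than
`η n`. -/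
def recordDeviation (q η : ℝ) (n : ℕ) : Set (Equiv.Perm (Fin n)) :=
  {σ | ∃ k : Fin n, η * n < |(recordCount σ.symm k : ℝ) - (1 - q) * (k : ℕ)|}

theorem one_le_exp_add_exp_of_lt_abs {η x y : ℝ} (hη : 0 < η) (h : y < |x|) :
    1 ≤ Real.exp (η * (x - y)) + Real.exp (-η * x - η * y) := by
  rcases lt_abs.1 h with h | h
  · have : 1 ≤ Real.exp (η * (x - y)) := Real.one_le_exp (by nlinarith)
    linarith [Real.exp_pos (-η * x - η * y)]
  · have : 1 ≤ Real.exp (-η * x - η * y) := Real.one_le_exp (by nlinarith)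
    linarith [Real.exp_pos (η * (x - y))]

theorem sum_exp_recordCount_le {q s : ℝ} (hq0 : 0 ≤ q) (hq1 : q < 1) (hs : |s| ≤ 1) {n k : ℕ}
    (hk : k ≤ n) :
    ∑ τ : Equiv.Perm (Fin n), q ^ invCount τ *
      Real.exp (s * ((recordCount τ k : ℝ) - (1 - q) * k)) ≤
      mallowsZ n q * Real.exp (s ^ 2 * n + 2 / (1 - q)) := by
  have h1 : ∑ τ : Equiv.Perm (Fin n), q ^ invCount τ *
      Real.exp (s * ((recordCount τ k : ℝ) - (1 - q) * k)) =
      recordSum q n k (Real.exp s) * Real.exp (-(s * ((1 - q) * k))) := by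
    rw [recordSum, Finset.sum_mul]
    refine Finset.sum_congr rfl fun τ _ => ?_
    rw [mul_assoc, ← Real.exp_nat_mul, ← Real.exp_add]
    ring_nf
  rw [h1]
  refine (mul_le_mul_of_nonneg_right (recordSum_exp_le hq0 hq1 hs hk)
    (Real.exp_pos _).le).trans ?_
  rw [mul_assoc, ← Real.exp_add]
  refine mul_le_mul_of_nonneg_left (Real.exp_le_exp.2 ?_) (mallowsZ_pos hq0 n).le
  have hk' : (k : ℝ) ≤ n := by exact_mod_cast hk
  have : (1 - q) * k ≤ n := by nlinarith [mul_nonneg hq0 (Nat.cast_nonneg (α := ℝ) k)]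
  nlinarith [mul_le_mul_of_nonneg_left this (sq_nonneg s)]

theorem mallows_apply {q : ℝ} (hq0 : 0 ≤ q) {n : ℕ} (A : Set (Equiv.Perm (Fin n)))
    [DecidablePred (· ∈ A)] :
    mallows n q A = ENNReal.ofReal ((∑ σ with σ ∈ A, q ^ invCount σ) / mallowsZ n q) := by
  have hZ := mallowsZ_pos hq0 n
  rw [mallows, Measure.finsetSum_apply, Finset.sum_div, Finset.sum_filter,
    ENNReal.ofReal_sum_of_nonneg]
  · refine Finset.sum_congr rfl fun σ _ => ?_
    rw [Measure.smul_apply, Measure.dirac_apply' _ (MeasurableSpace.measurableSet_top)]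
    by_cases h : σ ∈ A <;> simp [h, mallowsProb]
  · intro σ _
    split_ifs
    · positivity
    · exact le_rfl

/-- Exponential Markov at `s = ±η / 2`, where `η ≤ 2` ensures `|s| ≤ 1`: the exponent is `η² n / 4 -
η² n / 2`. The factor `n` is the union bound over `k`. -/
theorem mallows_recordDeviation_le {q η : ℝ} (hq0 : 0 ≤ q) (hq1 : q < 1) (hη : 0 < η)
    (hη2 : η ≤ 2) (n : ℕ) :
    mallows n q (recordDeviation q η n) ≤
      ENNReal.ofReal (2 * Real.exp (2 / (1 - q)) * (n ^ 1 * Real.exp (-(η ^ 2 / 4) * n))) := by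
  classical
  rw [mallows_apply hq0]
  apply ENNReal.ofReal_le_ofReal
  have hZ := mallowsZ_pos hq0 n
  rw [div_le_iff₀ hZ]
  set x : Equiv.Perm (Fin n) → Fin n → ℝ :=
    fun τ k => (recordCount τ k : ℝ) - (1 - q) * (k : ℕ) with hx
  set w : Equiv.Perm (Fin n) → Fin n → ℝ := fun τ k =>
    Real.exp (η / 2 * (x τ k - η * n)) + Real.exp (-(η / 2) * x τ k - η / 2 * (η * n)) with hw
  have hwpos : ∀ τ k, 0 < w τ k := fun τ k => by positivity
  calc ∑ σ with σ ∈ recordDeviation q η n, q ^ invCount σ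
      ≤ ∑ σ with σ ∈ recordDeviation q η n, q ^ invCount σ * ∑ k, w σ.symm k := by
        refine Finset.sum_le_sum fun σ hσ => ?_
        obtain ⟨k, hk⟩ := (Finset.mem_filter.1 hσ).2
        refine le_mul_of_one_le_right (pow_nonneg hq0 _) ?_
        exact (one_le_exp_add_exp_of_lt_abs (half_pos hη) hk).trans
          (Finset.single_le_sum (f := fun k => w σ.symm k)
            (fun k _ => (hwpos _ k).le) (Finset.mem_univ k))
    _ ≤ ∑ σ : Equiv.Perm (Fin n), q ^ invCount σ * ∑ k, w σ.symm k :=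
        Finset.sum_le_sum_of_subset_of_nonneg (Finset.filter_subset _ _) fun σ _ _ =>
          mul_nonneg (pow_nonneg hq0 _) (Finset.sum_nonneg fun k _ => (hwpos _ k).le)
    -- Inversion preserves the Mallows weight, so the bounds for `τ` apply to `σ.symm`.
    _ = ∑ τ : Equiv.Perm (Fin n), q ^ invCount τ * ∑ k, w τ k := by
        rw [← (Equiv.symm_bijective (α := Fin n) (β := Fin n)).sum_comp]
        refine Finset.sum_congr rfl fun τ _ => ?_
        rw [invCount_symm, Equiv.symm_symm]
    _ = ∑ k, ∑ τ : Equiv.Perm (Fin n), q ^ invCount τ * w τ k := by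
        simp_rw [Finset.mul_sum]
        exact Finset.sum_comm
    _ ≤ ∑ k : Fin n, 2 * (mallowsZ n q * Real.exp ((η / 2) ^ 2 * n + 2 / (1 - q))) *
          Real.exp (-(η / 2 * (η * n))) := by
        refine Finset.sum_le_sum fun k _ => ?_
        have hs : |η / 2| ≤ 1 := by rw [abs_of_pos (half_pos hη)]; linarith
        have e1 := sum_exp_recordCount_le hq0 hq1 hs k.2.le
        have e2 := sum_exp_recordCount_le (s := -(η / 2)) hq0 hq1 (by rwa [abs_neg]) k.2.le
        rw [neg_sq] at e2
        have : ∑ τ : Equiv.Perm (Fin n), q ^ invCount τ * w τ k =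
            (∑ τ : Equiv.Perm (Fin n), q ^ invCount τ * Real.exp (η / 2 * x τ k) +
            ∑ τ : Equiv.Perm (Fin n), q ^ invCount τ * Real.exp (-(η / 2) * x τ k)) *
            Real.exp (-(η / 2 * (η * n))) := by
          rw [← Finset.sum_add_distrib, Finset.sum_mul]
          refine Finset.sum_congr rfl fun τ _ => ?_
          rw [hw, add_mul, mul_assoc, mul_assoc, ← Real.exp_add, ← Real.exp_add]
          ring_nf
        rw [this]
        refine mul_le_mul_of_nonneg_right ?_ (Real.exp_pos _).le
        linarith
    _ = 2 * Real.exp (2 / (1 - q)) * (n ^ 1 * Real.exp (-(η ^ 2 / 4) * n)) * mallowsZ n q := by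
        rw [Finset.sum_const, Finset.card_univ, Fintype.card_fin, nsmul_eq_mul, mul_assoc 2,
          mul_assoc (mallowsZ n q), ← Real.exp_add]
        have : (η / 2) ^ 2 * n + 2 / (1 - q) + -(η / 2 * (η * n)) =
          2 / (1 - q) + -(η ^ 2 / 4) * n := by ring
        rw [this, Real.exp_add]
        ring

end MallowsGHP

namespace MallowsGHP

/-! ## Binary words and distances in binary search trees -/

/-- The number of letters `1` at the beginning of a binary word. -/
def lead : List Bool → ℕ
  | [] => 0
  | false :: _ => 0
  | true :: u => lead u + 1

theorem exists_eq_replicate_append (u : List Bool) :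
    ∃ v, u = List.replicate (lead u) true ++ v := by
  induction u with
  | nil => exact ⟨[], rfl⟩
  | cons b u ih =>
    cases b with
    | false => exact ⟨false :: u, rfl⟩
    | true =>
      obtain ⟨v, hv⟩ := ih
      refine ⟨v, ?_⟩
      rw [lead, List.replicate_succ, List.cons_append, ← hv]

theorem lead_le_length (u : List Bool) : lead u ≤ u.length := by
  induction u with
  | nil => simp [lead]
  | cons b u ih => cases b <;> simp [lead, ih]

theorem lead_append_le (u v : List Bool) : lead u ≤ lead (u ++ v) := by
  induction u with
  | nil => simp [lead]
  | cons b u ih => cases b <;> simp [lead, ih]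

theorem lead_append_singleton_le (u : List Bool) (b : Bool) : lead (u ++ [b]) ≤ lead u + 1 := by
  induction u with
  | nil => cases b <;> simp [lead]
  | cons c u ih => cases c <;> simp [lead, ih]

theorem lead_replicate (m : ℕ) : lead (List.replicate m true) = m := by
  induction m with
  | zero => rfl
  | succ m ih => rw [List.replicate_succ, lead, ih]

theorem lead_take {u : List Bool} {i : ℕ} (hi : lead u ≤ i) : lead (u.take i) = lead u := by
  apply le_antisymm
  · conv_rhs => rw [← List.take_append_drop i u]
    exact lead_append_le _ _
  · obtain ⟨v, hv⟩ := exists_eq_replicate_append u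
    have h : List.take i u = List.replicate (lead u) true ++ List.take (i - lead u) v := by
      conv_lhs => rw [hv]
      rw [List.take_append, List.length_replicate, List.take_of_length_le (by simpa using hi)]
    rw [h]
    conv_lhs => rw [← lead_replicate (lead u)]
    exact lead_append_le _ _

theorem binaryTree_adj_lead {u v : List Bool} (h : binaryTree.Adj u v) :
    lead u ≤ lead v + 1 ∧ lead v ≤ lead u + 1 := by
  rcases h with ⟨b, rfl⟩ | ⟨b, rfl⟩
  · have := lead_append_le u [b]
    exact ⟨by omega, lead_append_singleton_le u b⟩
  · have := lead_append_le v [b]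
    exact ⟨lead_append_singleton_le v b, by omega⟩

section Distance

variable {n : ℕ} {σ : Equiv.Perm (Fin n)}

theorem lead_sub_lead_le_length {u v : (bst (List.ofFn σ) : Set (List Bool))}
    (p : (bstGraph σ).Walk u v) : |(lead u.1 : ℝ) - lead v.1| ≤ p.length := by
  induction p with
  | nil => simp
  | @cons u v w h p ih =>
    obtain ⟨h1, h2⟩ := binaryTree_adj_lead (show binaryTree.Adj u.1 v.1 from h)
    have h1' : (lead u.1 : ℝ) ≤ lead v.1 + 1 := by exact_mod_cast h1
    have h2' : (lead v.1 : ℝ) ≤ lead u.1 + 1 := by exact_mod_cast h2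
    rw [SimpleGraph.Walk.length_cons]
    push_cast
    rw [abs_le] at ih ⊢
    constructor <;> linarith [ih.1, ih.2]

theorem abs_lead_sub_lead_le_dist [NeZero n] (u v : (bst (List.ofFn σ) : Set (List Bool))) :
    |(lead u.1 : ℝ) - lead v.1| ≤ (bstGraph σ).dist u v := by
  obtain ⟨p, hp⟩ := (bstGraph_connected σ).exists_walk_length_eq_dist u v
  rw [← hp]
  exact lead_sub_lead_le_length p

theorem bstGraph_dist_append_le [NeZero n] (u w : List Bool)
    (hu : u ∈ (bst (List.ofFn σ) : Set (List Bool)))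
    (huw : u ++ w ∈ (bst (List.ofFn σ) : Set (List Bool))) :
    (bstGraph σ).dist ⟨u, hu⟩ ⟨u ++ w, huw⟩ ≤ w.length := by
  induction w using List.reverseRecOn with
  | nil => simp
  | append_singleton w b ih =>
    have hw : u ++ w ∈ (bst (List.ofFn σ) : Set (List Bool)) :=
      mem_bst_of_append (u ++ w) [b] _ (by simpa using huw)
    refine ((bstGraph_connected σ).dist_triangle (v := ⟨u ++ w, hw⟩)).trans ?_
    rw [List.length_append]
    refine Nat.add_le_add (ih hw) (le_of_eq ?_)
    rw [List.length_singleton, SimpleGraph.dist_eq_one_iff_adj]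
    exact Or.inl ⟨b, by simp⟩

/-- Walk from `u` to the spine, along it, and out to `v`. -/
theorem bstGraph_dist_le [NeZero n] (u v : (bst (List.ofFn σ) : Set (List Bool))) :
    ((bstGraph σ).dist u v : ℝ) ≤ |(lead u.1 : ℝ) - lead v.1| +
      ((u.1.length - lead u.1 : ℕ) : ℝ) + ((v.1.length - lead v.1 : ℕ) : ℝ) := by
  wlog h : lead u.1 ≤ lead v.1 generalizing u v
  · have := this v u (by omega)
    rw [SimpleGraph.dist_comm, abs_sub_comm] at this
    linarith
  have spine : ∀ u : (bst (List.ofFn σ) : Set (List Bool)),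
      ∃ hu : List.replicate (lead u.1) true ∈ (bst (List.ofFn σ) : Set (List Bool)),
        (bstGraph σ).dist ⟨_, hu⟩ u ≤ u.1.length - lead u.1 := by
    rintro ⟨u, hu⟩
    obtain ⟨w, hw⟩ := exists_eq_replicate_append u
    have hw' : List.replicate (lead u) true ++ w ∈ (bst (List.ofFn σ) : Set (List Bool)) :=
      hw ▸ hu
    have hr : List.replicate (lead u) true ∈ (bst (List.ofFn σ) : Set (List Bool)) :=
      mem_bst_of_append _ w _ hw'
    refine ⟨hr, ?_⟩
    have hl : w.length = u.length - lead u := by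
      have := congrArg List.length hw
      rw [List.length_append, List.length_replicate] at this
      omega
    have := bstGraph_dist_append_le _ w hr hw'
    rw [hl] at this
    simpa only [← hw] using this
  obtain ⟨hu, hu'⟩ := spine u
  obtain ⟨hv, hv'⟩ := spine v
  have hsplit : List.replicate (lead v.1) true =
      List.replicate (lead u.1) true ++ List.replicate (lead v.1 - lead u.1) true := by
    rw [← List.replicate_add, Nat.add_sub_cancel' h]
  have huv := bstGraph_dist_append_le _ (List.replicate (lead v.1 - lead u.1) true) hu
    (hsplit ▸ hv)
  simp only [← hsplit, List.length_replicate] at huv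
  have t1 := (bstGraph_connected σ).dist_triangle (u := u) (v := ⟨_, hu⟩) (w := v)
  have t2 := (bstGraph_connected σ).dist_triangle (u := ⟨_, hu⟩) (v := ⟨_, hv⟩) (w := v)
  rw [SimpleGraph.dist_comm] at hu'
  have : (bstGraph σ).dist u v ≤ (lead v.1 - lead u.1) + (u.1.length - lead u.1) +
      (v.1.length - lead v.1) := by omega
  have h' : (lead u.1 : ℝ) ≤ lead v.1 := by exact_mod_cast h
  rw [abs_sub_comm, abs_of_nonneg (by linarith), ← Nat.cast_sub h]
  exact_mod_cast this

end Distance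

/-! ## The entries of a sequence as nodes of its binary search tree -/

/-- Here `f` plays the role of the position in the list. Stating order of appearance through `f`
lets the hypothesis pass to the filtered lists of both subtrees, where the induction on length
applies. -/
theorem exists_bijOn_bst {α β : Type*} [LinearOrder α] [LinearOrder β] (f : α → β) (l : List α)
    (hl : l.Pairwise fun a b => f a < f b) :
    ∃ path : α → List Bool, Set.BijOn path {x | x ∈ l} (bst l) ∧
      ∀ k ∈ l, lead (path k) = (l.toFinset.filter fun v => v < k ∧ ∀ w ∈ l, v < w → f v < f w).card := by
  induction hm : l.length using Nat.strong_induction_on generalizing l with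
  | _ m ih =>
  subst hm
  cases l with
  | nil => exact ⟨fun _ => [], by simp [bst, Set.BijOn, Set.MapsTo, Set.SurjOn]⟩
  | cons x xs =>
  rw [List.pairwise_cons] at hl
  obtain ⟨hx, hxs⟩ := hl
  have hlen : ∀ p : α → Bool, (xs.filter p).length < (x :: xs).length := fun p =>
    Nat.lt_succ_of_le (List.length_filter_le _ _)
  -- In the left subtree every word starts with `0`, so its `lead` clause is not needed.
  obtain ⟨p0, hp0, -⟩ := ih _ (hlen fun y => y < x) _ (hxs.filter _) rfl
  obtain ⟨p1, hp1, hlead⟩ := ih _ (hlen fun y => x < y) _ (hxs.filter _) rfl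
  have hne : ∀ y ∈ xs, y ≠ x := by
    rintro y hy rfl
    exact lt_irrefl _ (hx y hy)
  refine ⟨fun k => if k = x then [] else if k < x then false :: p0 k else true :: p1 k,
    ⟨?_, ?_, ?_⟩, ?_⟩
  · intro k hk
    rw [bst]
    rcases lt_trichotomy k x with h | rfl | h
    · have hk' : k ∈ xs := (List.mem_cons.1 hk).resolve_left h.ne
      have := hp0.mapsTo (show k ∈ xs.filter _ by simp [hk', h])
      simpa [h, h.ne] using this
    · simp
    · have hk' : k ∈ xs := (List.mem_cons.1 hk).resolve_left h.ne'
      have := hp1.mapsTo (show k ∈ xs.filter _ by simp [hk', h])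
      simpa [h.not_gt, h.ne'] using this
  · intro k hk k' hk' h
    dsimp only at h
    rcases lt_trichotomy k x with h1 | h1 | h1 <;> rcases lt_trichotomy k' x with h2 | h2 | h2
    · rw [if_neg h1.ne, if_pos h1, if_neg h2.ne, if_pos h2, List.cons.injEq] at h
      refine hp0.injOn ?_ ?_ h.2
      · simpa [h1] using (List.mem_cons.1 hk).resolve_left h1.ne
      · simpa [h2] using (List.mem_cons.1 hk').resolve_left h2.ne
    · simp [h1, h1.ne, h2] at h
    · simp [h1, h1.ne, h2.ne', h2.not_gt] at h
    · simp [h2, h2.ne, h1] at h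
    · exact h1.trans h2.symm
    · simp [h1, h2.ne', h2.not_gt] at h
    · simp [h2, h2.ne, h1.ne', h1.not_gt] at h
    · simp [h2, h1.ne', h1.not_gt] at h
    · rw [if_neg h1.ne', if_neg h1.not_gt, if_neg h2.ne', if_neg h2.not_gt, List.cons.injEq] at h
      refine hp1.injOn ?_ ?_ h.2
      · simpa [h1] using (List.mem_cons.1 hk).resolve_left h1.ne'
      · simpa [h2] using (List.mem_cons.1 hk').resolve_left h2.ne'
  · intro u hu
    rw [bst] at hu
    simp only [Finset.coe_union, Finset.coe_singleton, Finset.coe_image, Set.mem_union,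
      Set.mem_singleton_iff, Set.mem_image] at hu
    rcases hu with (rfl | ⟨u, hu, rfl⟩) | ⟨u, hu, rfl⟩
    · exact ⟨x, by simp, by simp⟩
    · obtain ⟨k, hk, rfl⟩ := hp0.surjOn hu
      have hk' : k ∈ xs ∧ k < x := by simpa using hk
      exact ⟨k, by simp [hk'.1], by simp [hk'.2, hk'.2.ne]⟩
    · obtain ⟨k, hk, rfl⟩ := hp1.surjOn hu
      have hk' : k ∈ xs ∧ x < k := by simpa using hk
      exact ⟨k, by simp [hk'.1], by simp [hk'.2.not_gt, hk'.2.ne']⟩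
  · intro k hk
    -- The head precedes everything, so no smaller entry is a record. Hence values up to `x` have
    -- count `0`; beyond `x` the count is one for the head plus that of the right sublist.
    have hrec : ∀ v ∈ xs, (∀ w ∈ x :: xs, v < w → f v < f w) → x < v := by
      intro v hv h
      by_contra hvx
      have := h x (by simp) (lt_of_le_of_ne (not_lt.1 hvx) (hne v hv))
      exact lt_asymm this (hx v hv)
    rcases le_or_gt k x with h | h
    · have h0 : lead (if k = x then [] else if k < x then false :: p0 k else true :: p1 k) = 0 := by
        rcases h.lt_or_eq with h | h
        · simp [h, h.ne, lead]
        · simp [h, lead]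
      rw [h0, eq_comm, Finset.card_eq_zero, Finset.filter_eq_empty_iff]
      rintro v hv ⟨hvk, hv'⟩
      rcases List.mem_cons.1 (List.mem_toFinset.1 hv) with rfl | hv
      · exact absurd hvk h.not_gt
      · exact absurd (hvk.trans_le h) (hrec v hv hv').not_gt
    · have hk' : k ∈ xs := (List.mem_cons.1 hk).resolve_left h.ne'
      dsimp only
      rw [if_neg h.ne', if_neg h.not_gt, lead, hlead k (by simp [hk', h])]
      have hins : (x :: xs).toFinset.filter
          (fun v => v < k ∧ ∀ w ∈ x :: xs, v < w → f v < f w) =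
          insert x ((xs.filter fun y => x < y).toFinset.filter fun v =>
            v < k ∧ ∀ w ∈ xs.filter fun y => x < y, v < w → f v < f w) := by
        ext v
        simp only [Finset.mem_filter, List.mem_toFinset, Finset.mem_insert, List.mem_filter,
          decide_eq_true_eq]
        constructor
        · rintro ⟨hv, hvk, hv'⟩
          rcases List.mem_cons.1 hv with rfl | hv
          · exact Or.inl rfl
          · exact Or.inr ⟨⟨hv, hrec v hv hv'⟩, hvk,
              fun w hw hvw => hv' w (List.mem_cons_of_mem _ hw.1) hvw⟩
        · rintro (rfl | ⟨⟨hv, hxv⟩, hvk, hv'⟩)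
          · refine ⟨by simp, h, fun w hw hvw => hx w ?_⟩
            exact (List.mem_cons.1 hw).resolve_left hvw.ne'
          · refine ⟨List.mem_cons_of_mem _ hv, hvk, fun w hw hvw => ?_⟩
            have hxw := hxv.trans hvw
            exact hv' w ⟨(List.mem_cons.1 hw).resolve_left hxw.ne', hxw⟩ hvw
      rw [hins, Finset.card_insert_of_notMem]
      simp

theorem exists_equiv_bst {n : ℕ} (σ : Equiv.Perm (Fin n)) :
    ∃ e : Fin n ≃ (bst (List.ofFn σ) : Set (List Bool)),
      ∀ k, lead (e k).1 = recordCount σ.symm k := by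
  obtain ⟨path, hb, hlead⟩ := exists_bijOn_bst σ.symm (List.ofFn σ) (by
    rw [List.pairwise_ofFn]
    intro i j hij
    simpa using hij)
  have hmem : ∀ k, k ∈ List.ofFn σ := fun k => (List.mem_ofFn' _ _).2 ⟨σ.symm k, by simp⟩
  refine ⟨(Equiv.Set.univ _).symm.trans ((Equiv.setCongr (Set.eq_univ_of_forall hmem).symm).trans
    hb.equiv), fun k => ?_⟩
  refine (hlead k (hmem k)).trans ?_
  rw [recordCount]
  congr 1
  ext v
  simp [hmem]

end MallowsGHP

namespace MallowsGHP

/-! ## Comparison of a finite weighted metric space with the unit interval -/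

/-- The index of the interval of length `1 / n` that contains `x`. -/
noncomputable def cellIndex (n : ℕ) [NeZero n] (x : unitInterval) : Fin n :=
  -- The truncation only acts at `x = 1`.
  ⟨min ⌊(n : ℝ) * x⌋₊ (n - 1), by have := NeZero.pos n; omega⟩

theorem measurable_cellIndex (n : ℕ) [NeZero n] : Measurable (cellIndex n) := by
  have h1 : Measurable fun x : unitInterval => ⌊(n : ℝ) * x⌋₊ :=
    Nat.measurable_floor.comp (measurable_subtype_coe.const_mul _)
  have h2 : Measurable fun m : ℕ =>
      (⟨min m (n - 1), by have := NeZero.pos n; omega⟩ : Fin n) := measurable_from_nat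
  exact h2.comp h1

theorem cellIndex_le (n : ℕ) [NeZero n] (x : unitInterval) :
    ((cellIndex n x : ℕ) : ℝ) ≤ n * x := by
  have h : ((cellIndex n x : ℕ) : ℝ) ≤ (⌊(n : ℝ) * x⌋₊ : ℝ) := by
    exact_mod_cast min_le_left _ _
  exact h.trans (Nat.floor_le (mul_nonneg (Nat.cast_nonneg _) x.2.1))

theorem le_cellIndex_add_one (n : ℕ) [NeZero n] (x : unitInterval) :
    n * (x : ℝ) ≤ (cellIndex n x : ℕ) + 1 := by
  have hn : 1 ≤ n := NeZero.pos n
  rcases le_total ⌊(n : ℝ) * x⌋₊ (n - 1) with h | h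
  · have : (cellIndex n x : ℕ) = ⌊(n : ℝ) * x⌋₊ := min_eq_left h
    rw [this]
    exact (Nat.lt_floor_add_one _).le
  · have : (cellIndex n x : ℕ) = n - 1 := min_eq_right h
    rw [this, Nat.cast_sub hn]
    have := x.2.2
    push_cast
    nlinarith [Nat.cast_nonneg (α := ℝ) n]

theorem cellIndex_eq (n : ℕ) [NeZero n] {k : Fin n} {x : unitInterval} (h1 : (k : ℕ) ≤ n * (x : ℝ))
    (h2 : n * (x : ℝ) < (k : ℕ) + 1) : cellIndex n x = k := by
  have h : ⌊(n : ℝ) * x⌋₊ = k :=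
    (Nat.floor_eq_iff ((Nat.cast_nonneg _).trans h1)).2 ⟨h1, h2⟩
  apply Fin.ext
  show min ⌊(n : ℝ) * x⌋₊ (n - 1) = k
  rw [h]
  have := k.2
  omega

/-- The `k`-th subdivision point of the unit interval. -/
noncomputable def cellPoint {n k : ℕ} (hk : k ≤ n) : unitInterval :=
  ⟨k / n, by positivity, div_le_one_of_le₀ (by exact_mod_cast hk) (Nat.cast_nonneg _)⟩

/-- The cell lies between the half-open and the closed interval of length `1 / n`, which avoids
treating the last cell separately. -/
theorem volume_cellIndex_preimage (n : ℕ) [NeZero n] (k : Fin n) :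
    (volume : Measure unitInterval) (cellIndex n ⁻¹' {k}) = (n : ENNReal)⁻¹ := by
  have hn : (0 : ℝ) < n := Nat.cast_pos.2 (NeZero.pos n)
  have hlen : ENNReal.ofReal ((cellPoint (Nat.succ_le_of_lt k.2) : ℝ) - cellPoint k.2.le) =
      (n : ENNReal)⁻¹ := by
    have : ((cellPoint (Nat.succ_le_of_lt k.2) : ℝ) - cellPoint k.2.le) = (n : ℝ)⁻¹ := by
      simp only [cellPoint]
      push_cast
      field_simp
      ring
    rw [this, ENNReal.ofReal_inv_of_pos hn, ENNReal.ofReal_natCast]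
  apply le_antisymm
  · rw [← hlen, ← unitInterval.volume_Icc]
    apply measure_mono
    rintro x rfl
    constructor
    · rw [← Subtype.coe_le_coe]
      exact (div_le_iff₀ hn).2 (by linarith [cellIndex_le n x])
    · rw [← Subtype.coe_le_coe]
      refine (le_div_iff₀ hn).2 ?_
      push_cast
      linarith [le_cellIndex_add_one n x]
  · rw [← hlen, ← unitInterval.volume_Ico]
    apply measure_mono
    rintro x ⟨h1, h2⟩
    rw [← Subtype.coe_le_coe] at h1
    rw [← Subtype.coe_lt_coe] at h2
    have h1' := (div_le_iff₀ hn).1 h1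
    have h2' := (lt_div_iff₀ hn).1 h2
    push_cast at h2'
    exact cellIndex_eq n (by linarith) (by linarith)

/-- The correspondence is the graph of `x ↦ e (cellIndex n x)` and the coupling is the image of
Lebesgue measure on it. Rounding two points to their cells costs `2 / n`. -/
theorem exists_coupling_unitInterval (X : WeightedMetricSpace) {n : ℕ} [NeZero n]
    (e : Fin n ≃ X.carrier) (hμ : ∀ k, X.μ {e k} = (n : ENNReal)⁻¹) {δ : ℝ} (hδ : 0 ≤ δ)
    (h : ∀ k l, |dist (e k) (e l) - |((k : ℕ) : ℝ) - (l : ℕ)| / n| ≤ δ) :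
    ∃ (C : Set (X.carrier × unitInterval)) (M : Measure (X.carrier × unitInterval)),
      IsCorrespondence C ∧ MeasurableSet C ∧ IsCoupling X.μ volume M ∧ M C = 1 ∧
        distortion C ≤ δ + 2 / n := by
  have hn : (0 : ℝ) < n := Nat.cast_pos.2 (NeZero.pos n)
  have : Finite X.carrier := Finite.of_equiv _ e
  have hidx : Measurable fun x : unitInterval => e (cellIndex n x) :=
    measurable_from_top.comp (measurable_cellIndex n)
  have hpair : Measurable fun x : unitInterval => (e (cellIndex n x), x) :=
    hidx.prodMk measurable_id
  have hC : MeasurableSet {p : X.carrier × unitInterval | p.1 = e (cellIndex n p.2)} :=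
    measurableSet_eq_fun measurable_fst (hidx.comp measurable_snd)
  refine ⟨{p | p.1 = e (cellIndex n p.2)}, volume.map fun x => (e (cellIndex n x), x),
    ⟨?_, ?_⟩, hC, ⟨?_, ?_, ?_⟩, ?_, ?_⟩
  · refine Set.eq_univ_of_forall fun v => ?_
    obtain ⟨k, rfl⟩ := e.surjective v
    refine ⟨(e k, cellPoint k.2.le), ?_, rfl⟩
    have hk : (n : ℝ) * ((cellPoint k.2.le : unitInterval) : ℝ) = (k : ℕ) :=
      mul_div_cancel₀ _ hn.ne'
    rw [Set.mem_ofPred_eq, cellIndex_eq n (k := k) hk.ge (by linarith)]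
  · exact Set.eq_univ_of_forall fun x => ⟨(e (cellIndex n x), x), rfl, rfl⟩
  · exact Measure.isProbabilityMeasure_map hpair.aemeasurable
  · rw [Measure.map_map measurable_fst hpair]
    refine Measure.ext_of_singleton fun v => ?_
    obtain ⟨k, rfl⟩ := e.surjective v
    rw [Measure.map_apply (measurable_fst.comp hpair) (measurableSet_singleton _), hμ,
      ← volume_cellIndex_preimage n k]
    congr 1
    ext x
    simp
  · rw [Measure.map_map measurable_snd hpair]
    exact Measure.map_id
  · rw [Measure.map_apply hpair hC]
    simp
  · refine Real.sSup_le ?_ (by positivity)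
    rintro r ⟨⟨u, x⟩, hu, ⟨v, y⟩, hv, rfl⟩
    obtain rfl : u = e (cellIndex n x) := hu
    obtain rfl : v = e (cellIndex n y) := hv
    have hxy := h (cellIndex n x) (cellIndex n y)
    have hx : |((cellIndex n x : ℕ) : ℝ) / n - x| ≤ 1 / n := by
      rw [abs_le]
      have h1 := (div_le_iff₀' hn).2 (cellIndex_le n x)
      have h2 := (le_div_iff₀' hn).2 (le_cellIndex_add_one n x)
      rw [add_div] at h2
      have : 0 < 1 / (n : ℝ) := by positivity
      constructor <;> linarith
    have hy : |((cellIndex n y : ℕ) : ℝ) / n - y| ≤ 1 / n := by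
      rw [abs_le]
      have h1 := (div_le_iff₀' hn).2 (cellIndex_le n y)
      have h2 := (le_div_iff₀' hn).2 (le_cellIndex_add_one n y)
      rw [add_div] at h2
      have : 0 < 1 / (n : ℝ) := by positivity
      constructor <;> linarith
    have hd : abs (|((cellIndex n x : ℕ) : ℝ) - (cellIndex n y : ℕ)| / n - dist x y) ≤ 2 / n := by
      rw [show dist x y = |(x : ℝ) - y| from rfl]
      conv_lhs => rw [← abs_of_pos hn, ← abs_div, sub_div]
      refine (abs_abs_sub_abs_le _ _).trans ?_
      rw [show ((cellIndex n x : ℕ) : ℝ) / n - (cellIndex n y : ℕ) / n - (x - y) =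
        ((cellIndex n x : ℕ) / n - x) - ((cellIndex n y : ℕ) / n - y) by ring]
      refine (abs_sub _ _).trans ?_
      rw [show (2 : ℝ) / n = 1 / n + 1 / n by ring]
      exact add_le_add hx hy
    exact (abs_sub_le _ _ _).trans (add_le_add hxy hd)

theorem ghpDist_unitIntervalSpace_le (X : WeightedMetricSpace) {n : ℕ} [NeZero n]
    (e : Fin n ≃ X.carrier) (hμ : ∀ k, X.μ {e k} = (n : ENNReal)⁻¹) {δ : ℝ} (hδ : 0 ≤ δ)
    (h : ∀ k l, |dist (e k) (e l) - |((k : ℕ) : ℝ) - (l : ℕ)| / n| ≤ δ) :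
    ghpDist X unitIntervalSpace ≤ δ / 2 + 1 / n := by
  have hn : (0 : ℝ) < n := Nat.cast_pos.2 (NeZero.pos n)
  obtain ⟨C, M, hC, hCm, hM, hMC, hdist⟩ := exists_coupling_unitInterval X e hμ hδ h
  refine csInf_le ⟨0, fun ε hε => hε.1.le⟩ ⟨by positivity, C, M, hC, hCm, hM, ?_, ?_⟩
  · refine le_of_le_of_eq ?_ hMC.symm
    rw [ENNReal.ofReal_le_one]
    have : 0 < δ / 2 + 1 / (n : ℝ) := by positivity
    linarith
  · refine le_trans hdist (le_of_eq ?_)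
    ring

theorem graphSpace_measure_singleton {V : Type} [Finite V] (G : SimpleGraph V) (hG : G.Connected)
    (c : ℝ) (hc : 0 < c) (v : V) :
    (graphSpace G hG c hc).μ ({v} : Set V) = (Nat.card V : ENNReal)⁻¹ := by
  let : MeasurableSpace V := ⊤
  let := Fintype.ofFinite V
  have h : uniformOn (Set.univ : Set V) {v} = (Nat.card V : ENNReal)⁻¹ := by
    rw [uniformOn_univ, Measure.count_singleton, one_div, Nat.card_eq_fintype_card]
  exact h

theorem ghpDist_nonneg (X Y : WeightedMetricSpace) : 0 ≤ ghpDist X Y :=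
  Real.sInf_nonneg fun _ h => h.1.le

/-! ## The search tree of a permutation with regularly spaced records -/

section Tree

variable {n : ℕ} {σ : Equiv.Perm (Fin n)}

/-- The `t + 1` prefixes of `u` of length at least `lead u` are distinct nodes with the same `lead`.
Their extreme labels differ by at least `t`, while the hypothesis at these two labels allows a gap
of at most `2 * D / a`. -/
theorem length_sub_lead_le {a D : ℝ} (ha : 0 < a)
    (e : Fin n ≃ (bst (List.ofFn σ) : Set (List Bool)))
    (he : ∀ k, |(lead (e k).1 : ℝ) - a * (k : ℕ)| ≤ D) (k : Fin n) :
    (((e k).1.length - lead (e k).1 : ℕ) : ℝ) ≤ 2 * D / a := by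
  classical
  set u := (e k).1 with hu
  set t := u.length - lead u with ht
  have hlu := lead_le_length u
  have hmem : ∀ i, u.take i ∈ (bst (List.ofFn σ) : Set (List Bool)) := fun i =>
    mem_bst_of_append _ (u.drop i) _ (by rw [List.take_append_drop]; exact (e k).2)
  set g : ℕ → Fin n := fun i => e.symm ⟨u.take (lead u + i), hmem _⟩ with hg
  set S := (Finset.range (t + 1)).image g with hS
  have hcard : S.card = t + 1 := by
    rw [hS, Finset.card_image_of_injOn, Finset.card_range]
    intro i hi j hj hij
    have h1 := congrArg (fun x => List.length x.1) (e.symm.injective hij)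
    simp only [List.length_take] at h1
    simp only [Finset.coe_range, Set.mem_Iio] at hi hj
    omega
  have hlead : ∀ x ∈ S, lead (e x).1 = lead u := by
    intro x hx
    obtain ⟨i, -, rfl⟩ := Finset.mem_image.1 hx
    simp only [hg, Equiv.apply_symm_apply]
    exact lead_take (Nat.le_add_right _ _)
  have hne : S.Nonempty := Finset.card_pos.1 (by omega)
  have hsub : S ⊆ Finset.Icc (S.min' hne) (S.max' hne) := fun x hx =>
    Finset.mem_Icc.2 ⟨S.min'_le x hx, S.le_max' x hx⟩
  have hle := Finset.card_le_card hsub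
  rw [hcard, Fin.card_Icc] at hle
  have hle' : (S.min' hne : ℕ) + t ≤ (S.max' hne : ℕ) := by
    have : (S.min' hne : ℕ) ≤ S.max' hne := S.min'_le_max' hne
    omega
  have hle'' : ((S.min' hne : ℕ) : ℝ) + t ≤ (S.max' hne : ℕ) := by exact_mod_cast hle'
  have h1 := abs_le.1 (he (S.min' hne))
  have h2 := abs_le.1 (he (S.max' hne))
  rw [hlead _ (S.min'_mem hne)] at h1
  rw [hlead _ (S.max'_mem hne)] at h2
  rw [le_div_iff₀ ha]
  nlinarith [mul_le_mul_of_nonneg_left hle'' ha.le]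

/-- `2 * D` comes from the heights on the spine, and `2 * D / a` from each of the two excursions. -/
theorem abs_dist_sub_le [NeZero n] {a D : ℝ} (ha : 0 < a)
    (e : Fin n ≃ (bst (List.ofFn σ) : Set (List Bool)))
    (he : ∀ k, |(lead (e k).1 : ℝ) - a * (k : ℕ)| ≤ D) (k l : Fin n) :
    abs (((bstGraph σ).dist (e k) (e l) : ℝ) - a * |((k : ℕ) : ℝ) - (l : ℕ)|) ≤
      2 * D + 4 * D / a := by
  have h1 := abs_lead_sub_lead_le_dist (e k) (e l)
  have h2 := bstGraph_dist_le (e k) (e l)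
  have h3 := length_sub_lead_le ha e he k
  have h4 := length_sub_lead_le ha e he l
  have h5 : abs (|(lead (e k).1 : ℝ) - lead (e l).1| - a * |((k : ℕ) : ℝ) - (l : ℕ)|) ≤ 2 * D := by
    conv_lhs => rw [← abs_of_pos ha, ← abs_mul]
    refine (abs_abs_sub_abs_le _ _).trans ?_
    rw [show (lead (e k).1 : ℝ) - lead (e l).1 - a * (((k : ℕ) : ℝ) - (l : ℕ)) =
      (lead (e k).1 - a * (k : ℕ)) - (lead (e l).1 - a * (l : ℕ)) by ring]
    refine (abs_sub _ _).trans ?_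
    linarith [he k, he l]
  have h6 := abs_le.1 h5
  have h7 : 4 * D / a = 2 * D / a + 2 * D / a := by ring
  have h8 : 0 ≤ 2 * D / a := (Nat.cast_nonneg _).trans h3
  rw [abs_le]
  constructor <;> linarith

theorem ghpDist_treeSpace_le [NeZero n] {q η : ℝ} (hq1 : q < 1) (hη : 0 ≤ η)
    (hσ : σ ∉ recordDeviation q η n) :
    ghpDist (treeSpace q hq1 σ) unitIntervalSpace ≤
      (1 + 2 / (1 - q)) / (1 - q) * η + 1 / n := by
  have hn : (0 : ℝ) < n := Nat.cast_pos.2 (NeZero.pos n)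
  have ha : 0 < 1 - q := by linarith
  obtain ⟨e, he⟩ := exists_equiv_bst σ
  have he' : ∀ k, |(lead (e k).1 : ℝ) - (1 - q) * (k : ℕ)| ≤ η * n := by
    intro k
    rw [he]
    by_contra hk
    exact hσ ⟨k, not_le.1 hk⟩
  -- This `δ` is `2 * D + 4 * D / a` with `D = η * n` and `a = 1 - q`, divided by `(1 - q) * n`.
  have hmain := ghpDist_unitIntervalSpace_le (treeSpace q hq1 σ) e
    (δ := 2 * ((1 + 2 / (1 - q)) / (1 - q) * η)) ?_ (by positivity) ?_
  · refine hmain.trans_eq ?_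
    ring
  · intro k
    have hcard : Nat.card (bst (List.ofFn σ) : Set (List Bool)) = n := by
      rw [← Nat.card_congr e, Nat.card_fin]
    exact (graphSpace_measure_singleton _ _ _ _ (e k)).trans (by rw [hcard])
  · intro k l
    have h := abs_dist_sub_le ha e he' k l
    change |((1 - q) * n)⁻¹ * ((bstGraph σ).dist (e k) (e l) : ℝ) -
      |((k : ℕ) : ℝ) - (l : ℕ)| / n| ≤ _
    rw [show ((1 - q) * n)⁻¹ * ((bstGraph σ).dist (e k) (e l) : ℝ) -
      |((k : ℕ) : ℝ) - (l : ℕ)| / n = ((1 - q) * n)⁻¹ * (((bstGraph σ).dist (e k) (e l) : ℝ) -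
      (1 - q) * |((k : ℕ) : ℝ) - (l : ℕ)|) by field_simp, abs_mul,
      abs_of_pos (inv_pos.2 (mul_pos ha hn))]
    refine (mul_le_mul_of_nonneg_left h (inv_pos.2 (mul_pos ha hn)).le).trans_eq ?_
    field_simp
    ring

end Tree

end MallowsGHP

namespace MallowsGHP

/-! ## Almost sure convergence -/

theorem ae_eventually_notMem_recordDeviation {q η : ℝ} (hq0 : 0 ≤ q) (hq1 : q < 1) (hη : 0 < η)
    (hη2 : η ≤ 2) {Ω : Type*} [MeasurableSpace Ω] (P : Measure Ω)
    (σ : (n : ℕ) → Ω → Equiv.Perm (Fin n))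
    (hσ : ∀ n : ℕ, 1 ≤ n → HasLaw (σ n) (mallows n q) P) :
    ∀ᵐ ω ∂P, ∀ᶠ n : ℕ in atTop, σ (n + 1) ω ∉ recordDeviation q η (n + 1) := by
  have hP : ∀ n : ℕ, P {ω | σ (n + 1) ω ∈ recordDeviation q η (n + 1)} ≤ ENNReal.ofReal
      (2 * Real.exp (2 / (1 - q)) * (((n + 1 : ℕ) : ℝ) ^ 1 *
        Real.exp (-(η ^ 2 / 4) * (n + 1 : ℕ)))) := fun n =>
    ((hσ (n + 1) (by omega)).measure_eq
      (p := fun σ => σ ∈ recordDeviation q η (n + 1)) MeasurableSpace.measurableSet_top).trans_le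
        (mallows_recordDeviation_le hq0 hq1 hη hη2 (n + 1))
  have hsum : Summable fun n : ℕ => 2 * Real.exp (2 / (1 - q)) * (((n + 1 : ℕ) : ℝ) ^ 1 *
      Real.exp (-(η ^ 2 / 4) * (n + 1 : ℕ))) :=
    (((summable_nat_add_iff 1).2
      (Real.summable_pow_mul_exp_neg_nat_mul 1 (by positivity : 0 < η ^ 2 / 4))).mul_left _)
  refine ae_eventually_notMem (ne_top_of_le_ne_top hsum.tsum_ofReal_ne_top
    (ENNReal.tsum_le_tsum hP))

end MallowsGHP

theorem theorem4 (q : ℝ) (hq0 : 0 ≤ q) (hq1 : q < 1)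
    {Ω : Type*} [MeasurableSpace Ω] (P : Measure Ω) [IsProbabilityMeasure P]
    (σ : (n : ℕ) → Ω → Equiv.Perm (Fin n))
    (hσ : ∀ n : ℕ, 1 ≤ n → HasLaw (σ n) (MallowsGHP.mallows n q) P) :
    MallowsGHP.StrongGHPTendsto P
      (fun n ω => MallowsGHP.treeSpace q hq1 (σ (n + 1) ω))
      MallowsGHP.unitIntervalSpace := by
  -- Countably many tolerances `1 / (m + 1)` give one almost sure event on which every `η` is
  -- available.
  have hgood : ∀ᵐ ω ∂P, ∀ m : ℕ, ∀ᶠ n : ℕ in atTop,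
      σ (n + 1) ω ∉ MallowsGHP.recordDeviation q (1 / ((m : ℝ) + 1)) (n + 1) :=
    ae_all_iff.2 fun m => MallowsGHP.ae_eventually_notMem_recordDeviation hq0 hq1
      Nat.one_div_pos_of_nat ((Nat.one_div_le_one_div (Nat.zero_le m)).trans (by norm_num)) P σ hσ
  filter_upwards [hgood] with ω hω
  set K : ℝ := (1 + 2 / (1 - q)) / (1 - q)
  have hlim : Tendsto (fun m : ℕ => K * (1 / ((m : ℝ) + 1))) atTop (𝓝 0) := by
    simpa using tendsto_one_div_add_atTop_nhds_zero_nat.const_mul K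
  rw [Metric.tendsto_atTop']
  intro ε hε
  obtain ⟨m, hm⟩ := (hlim.eventually (gt_mem_nhds (half_pos hε))).exists
  have hn := (tendsto_one_div_add_atTop_nhds_zero_nat (𝕜 := ℝ)).eventually
    (gt_mem_nhds (half_pos hε))
  obtain ⟨N, hN⟩ := eventually_atTop.1 ((hω m).and hn)
  refine ⟨N, fun n hnN => ?_⟩
  obtain ⟨h1, h2⟩ := hN n hnN.le
  have h := MallowsGHP.ghpDist_treeSpace_le hq1 Nat.one_div_pos_of_nat.le h1
  rw [Real.dist_0_eq_abs, abs_of_nonneg (MallowsGHP.ghpDist_nonneg _ _)]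
  push_cast at h
  linarith
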